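/- Let $2\le d\le 12$ be an integer and, for $|x|<1$, let $\mathcal Z_d(x)=\prod_{i\ge 1}\frac{1}{1-dx^i}=\sum_{K\ge0}Z_d(K)x^K$ (product and power series being understood where they converge). For $n\ge 1$ and $0\le j\le n-1$ put $\omega_n=e^{2\pi i/n}$, $x_{n;j}=d^{-1/n}\omega_n^{j}$ (a root of $1-dx^n$), and $$c_{n;j}=\lim_{x\to x_{n;j}}\mathcal Z_d(x)\,\bigl(1-d^{1/n}\omega_n^{-j}x\bigr),\qquad Z_{d,n}(K)=\sum_{j=0}^{n-1}c_{n;j}\,\omega_n^{-jK}d^{K/n},$$ where $\mathcal Z_d$ is continued meromorphically to the unit disc by the product. Let $\mathrm{Li}_2(t)=\sum_{k\ge1}t^k/k^2$ and $F(d)=3\ln^2 d+6\,\mathrm{Li}_2(1/d)-\pi^2$. Then: 1. all the limits defining $c_{n;j}$ exist; 2. $F(d)<\pi^2$, so that $\lambda_d:=\dfrac{\pi^2-F(d)}{6\ln d}>0$; 3. the real-root coefficients grow exponentially: as $n\to\infty$, $$c_{n;0}\sim(-1)^{n-1}\,\frac{\sqrt{d-1}\,\ln d}{2\pi}\;n^{-2}\,e^{\lambda_d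 n},$$ in the sense that the ratio of the two sides tends to $1$; 4. the complex-root coefficients are exponentially smaller: there are $C,\delta>0$, depending only on $d$, with $|c_{n;j}|\le C e^{-\delta n}|c_{n;0}|$ for all $n\ge 1$ and $1\le j\le n-1$; and there are $C,\delta>0$, depending only on $d$, with $\bigl|\sum_{j=1}^{n-1}c_{n;j}\omega_n^{-jK}d^{K/n}\bigr|\le Ce^{-\delta n}\,|c_{n;0}|\,d^{K/n}$ for all $n\ge1$ and all integers $K\ge0$; 5. for every integer $K\ge 0$ one has $Z_{d,n}(K)\sim c_{n;0}\,d^{K/n}$ as $n\to\infty$; the terms grow exponentially, i.e. there is $\mu>0$ with $|Z_{d,n}(K)|\ge e^{\mu n}$ for all sufficiently large $n$; and the pole series $\sum_{n\ge1}Z_{d,n}(K)$ for $Z_d(K)$ diverges (its partial sums have no limit in $\mathbb C$). -/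

import Mathlib

open Filter Topology Asymptotics

noncomputable section

namespace DMatrix

/-- The `d`-matrix partition function `𝒵_d(x) = ∏_{i ≥ 1} 1 / (1 - d x^i)` (for `|x| < 1`). -/
def partitionFun (d : ℕ) (x : ℂ) : ℂ :=
  ∏' i : ℕ, 1 / (1 - (d : ℂ) * x ^ (i + 1))

/-- The root of unity `ω_n = e^{2πi/n}`. -/
def omega (n : ℕ) : ℂ :=
  Complex.exp (2 * (Real.pi : ℂ) * Complex.I / (n : ℂ))

/-- The pole `x_{n;j} = d^{-1/n} ω_n^j`, a root of `1 - d x^n`. -/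
def pole (d n j : ℕ) : ℂ :=
  (((d : ℝ) ^ (-(1 / (n : ℝ))) : ℝ) : ℂ) * omega n ^ j

/-- The linear factor `1 - d^{1/n} ω_n^{-j} x`, which vanishes exactly at `x = x_{n;j}`. -/
def poleFactor (d n j : ℕ) (x : ℂ) : ℂ :=
  1 - (((d : ℝ) ^ (1 / (n : ℝ)) : ℝ) : ℂ) * omega n ^ (-(j : ℤ)) * x

/-- The coefficient `c_{n;j} = lim_{x → x_{n;j}} 𝒵_d(x) (1 - d^{1/n} ω_n^{-j} x)`. -/
def coeff (d n j : ℕ) : ℂ :=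
  limUnder (𝓝[≠] (pole d n j)) (fun x => partitionFun d x * poleFactor d n j x)

/-- The contribution `c_{n;j} ω_n^{-jK} d^{K/n}` of the pole `x_{n;j}` to the coefficient
of `x^K`. -/
def poleTerm (d n j K : ℕ) : ℂ :=
  coeff d n j * omega n ^ (-((j : ℤ) * (K : ℤ))) * (((d : ℝ) ^ ((K : ℝ) / (n : ℝ)) : ℝ) : ℂ)

/-- The level-`n` term `Z_{d,n}(K) = ∑_{j=0}^{n-1} c_{n;j} ω_n^{-jK} d^{K/n}`. -/
def levelTerm (d n K : ℕ) : ℂ :=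
  ∑ j ∈ Finset.range n, poleTerm d n j K

/-- The dilogarithm `Li₂(t) = ∑_{k ≥ 1} t^k / k^2` (for `|t| ≤ 1`). -/
def Li₂ (t : ℝ) : ℝ :=
  ∑' k : ℕ, t ^ (k + 1) / ((k : ℝ) + 1) ^ 2

/-- `F(d) = 3 ln² d + 6 Li₂(1/d) - π²`. -/
def F (d : ℕ) : ℝ :=
  3 * Real.log d ^ 2 + 6 * Li₂ (1 / (d : ℝ)) - Real.pi ^ 2

/-- The exponential rate `(π² - F(d)) / (6 ln d)`. -/
def rate (d : ℕ) : ℝ :=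
  (Real.pi ^ 2 - F d) / (6 * Real.log d)

end DMatrix

end

namespace DMatrix

/-! Let `z` be a pole of level `n`, so `d z^n = 1`, and put `q = |z| = d^{-1/n}`. The factors of the
product beyond the `n`-th satisfy `d z^{n+k} = z^k`, and those before it satisfy `d z^{n-k} =
z^{-k}`. Hence the coefficient is explicit (`coeff_eq`): `(-1)^{n-1} n⁻¹ z^{n(n-1)/2} / ((z;z)_{n-1}
(z;z)_∞)`.

Complex roots: every `|1 - z^k|` is at least `1 - q^k`, its value at the real root. For `k < n` one
has `q^k ≥ 1/d`, so the factor also gains from the angle of `z^k`. Since `∑_{0<k<n} (1 - Re ω^{jk})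
= n`, the gains multiply to `e^{δn}` uniformly in `j` (`norm_coeff_le`).

Real root: `q^n = 1/d` gives `(q;q)_{n-1} = (q;q)_∞ / (1/d;q)_∞`, and `q = e^{-t}` with `t = ln d /
n → 0`. The modularity of `η` evaluates `(q;q)_∞` (`eulerProd_exp_neg`), and a Lambert series
evaluates `(1/d;q)_∞` to relative error `o(1)` (`exists_tprod_eq_exp_Li₂`). The exponents add up to
`n (π² - F(d)) / (6 ln d)`, positive by `F_lt_pi_sq`. Level terms therefore grow exponentially, and
their series cannot converge. -/

/-! ### Moduli and equations of the poles -/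

theorem norm_omega_zpow (n : ℕ) (k : ℤ) : ‖omega n ^ k‖ = 1 := by
  have : ‖omega n‖ = 1 := by
    rw [omega, show 2 * (Real.pi : ℂ) * Complex.I / (n : ℂ) =
      ((2 * Real.pi / n : ℝ) : ℂ) * Complex.I by push_cast; ring]
    exact Complex.norm_exp_ofReal_mul_I _
  simp [this]

theorem norm_omega_pow (n j : ℕ) : ‖omega n ^ j‖ = 1 := by
  simpa using norm_omega_zpow n j

theorem omega_isPrimitiveRoot {n : ℕ} (hn : 1 ≤ n) : IsPrimitiveRoot (omega n) n :=
  Complex.isPrimitiveRoot_exp n (by lia)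

/-- The common modulus `d^{-1/n}` of the poles of level `n`. -/
noncomputable def radius (d n : ℕ) : ℝ := (d : ℝ) ^ (-(1 / (n : ℝ)))

theorem radius_pos {d : ℕ} (hd : 2 ≤ d) (n : ℕ) : 0 < radius d n :=
  Real.rpow_pos_of_pos (by positivity) _

theorem radius_pow {d n : ℕ} (hn : 1 ≤ n) : radius d n ^ n = (d : ℝ)⁻¹ := by
  have : (n : ℝ) ≠ 0 := by positivity
  rw [radius, ← Real.rpow_natCast, ← Real.rpow_mul (by positivity)]
  rw [show -(1 / (n : ℝ)) * n = -1 by field_simp, Real.rpow_neg_one]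

theorem radius_lt_one {d n : ℕ} (hd : 2 ≤ d) (hn : 1 ≤ n) : radius d n < 1 := by
  have : (1 : ℝ) < d := by exact_mod_cast hd
  exact Real.rpow_lt_one_of_one_lt_of_neg this (by simp; lia)

theorem pole_eq (d n j : ℕ) : pole d n j = radius d n * omega n ^ j := rfl

theorem norm_pole {d : ℕ} (hd : 2 ≤ d) (n j : ℕ) : ‖pole d n j‖ = radius d n := by
  rw [pole_eq, norm_mul, norm_omega_pow, mul_one, Complex.norm_real,
    Real.norm_of_nonneg (radius_pos hd n).le]

theorem mul_pole_pow {d n : ℕ} (hd : 2 ≤ d) (hn : 1 ≤ n) (j : ℕ) :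
    (d : ℂ) * pole d n j ^ n = 1 := by
  have : (d : ℂ) ≠ 0 := by norm_cast; lia
  rw [pole_eq, mul_pow, ← pow_mul, mul_comm j, pow_mul, (omega_isPrimitiveRoot hn).pow_eq_one,
    one_pow, mul_one, ← Complex.ofReal_pow, radius_pow hn]
  simp [this]

theorem poleFactor_eq {d n : ℕ} (j : ℕ) (x : ℂ) :
    poleFactor d n j x = 1 - (pole d n j)⁻¹ * x := by
  rw [poleFactor, pole, mul_inv, zpow_neg, zpow_natCast, ← Complex.ofReal_inv,
    ← Real.rpow_neg (by positivity), neg_neg]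

/-! ### Existence and closed form of the coefficients -/

/-- Dominated convergence for products, with each factor written as `1 + u / (1 - u)`.
Multipliability near `z` is what permits splitting off the first `n` factors there. -/
theorem tendsto_tail_partition {d n : ℕ} (hd : 2 ≤ d) {z : ℂ} (hz1 : ‖z‖ < 1)
    (hz : (d : ℂ) * z ^ n = 1) :
    Tendsto (fun x : ℂ => ∏' i : ℕ, 1 / (1 - (d : ℂ) * x ^ (i + n + 1))) (𝓝 z)
      (𝓝 (∏' i : ℕ, (1 - z ^ (i + 1)))⁻¹) ∧
    ∀ᶠ x in 𝓝 z, Multipliable fun i : ℕ => 1 / (1 - (d : ℂ) * x ^ (i + n + 1)) := by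
  have hdpos : (0 : ℝ) < d := by positivity
  have hzd : (d : ℝ) * ‖z‖ ^ n = 1 := by
    simpa using congrArg norm hz
  have hcont : Tendsto (fun r : ℝ => (d : ℝ) * r ^ (n + 1)) (𝓝[>] ‖z‖)
      (𝓝 ((d : ℝ) * ‖z‖ ^ (n + 1))) :=
    (Continuous.tendsto (by fun_prop) _).mono_left nhdsWithin_le_nhds
  have hlt : (d : ℝ) * ‖z‖ ^ (n + 1) < 1 := by
    rw [pow_succ, ← mul_assoc, hzd, one_mul]; exact hz1
  -- Since `d |z|^{n+1} = |z| < 1`, a radius slightly larger than `|z|` still gives `ρ < 1`, which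
  -- keeps the tail denominators away from zero on a whole neighbourhood of `z`.
  obtain ⟨r, hrρ, hr1, hrz⟩ := ((hcont.eventually (gt_mem_nhds hlt)).and
    ((((gt_mem_nhds hz1).filter_mono nhdsWithin_le_nhds)).and self_mem_nhdsWithin)).exists
  set ρ := (d : ℝ) * r ^ (n + 1) with hρ
  have hrz' : ‖z‖ < r := hrz
  have hr0 : 0 < r := (norm_nonneg z).trans_lt hrz'
  have hρ0 : 0 < ρ := by positivity
  have hterm : ∀ x : ℂ, ‖x‖ < r → ∀ i : ℕ, ‖(d : ℂ) * x ^ (i + n + 1)‖ ≤ ρ * r ^ i := by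
    intro x hx i
    have : ‖x‖ ^ (i + n + 1) ≤ r ^ (i + n + 1) := by gcongr
    calc ‖(d : ℂ) * x ^ (i + n + 1)‖ = d * ‖x‖ ^ (i + n + 1) := by simp
      _ ≤ d * r ^ (i + n + 1) := by gcongr
      _ = ρ * r ^ i := by rw [hρ]; ring
  have hone : ∀ x : ℂ, ‖x‖ < r → ∀ i : ℕ, 1 - ρ ≤ ‖1 - (d : ℂ) * x ^ (i + n + 1)‖ := by
    intro x hx i
    have h1 := hterm x hx i
    have h2 : ρ * r ^ i ≤ ρ := mul_le_of_le_one_right hρ0.le (pow_le_one₀ hr0.le hr1.le)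
    have h3 := norm_sub_norm_le (1 : ℂ) ((d : ℂ) * x ^ (i + n + 1))
    rw [norm_one] at h3
    linarith
  have hsplit : ∀ x : ℂ, ‖x‖ < r → ∀ i : ℕ, 1 / (1 - (d : ℂ) * x ^ (i + n + 1)) =
      1 + (d : ℂ) * x ^ (i + n + 1) / (1 - (d : ℂ) * x ^ (i + n + 1)) := by
    intro x hx i
    have : 1 - (d : ℂ) * x ^ (i + n + 1) ≠ 0 := by
      rw [← norm_pos_iff]; linarith [hone x hx i]
    field_simp
    ring
  have hbound : ∀ x : ℂ, ‖x‖ < r → ∀ i : ℕ,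
      ‖(d : ℂ) * x ^ (i + n + 1) / (1 - (d : ℂ) * x ^ (i + n + 1))‖ ≤ ρ / (1 - ρ) * r ^ i := by
    intro x hx i
    rw [norm_div, div_mul_eq_mul_div]
    exact div_le_div₀ (by positivity) (hterm x hx i) (by linarith) (hone x hx i)
  have hsum : Summable fun i : ℕ => ρ / (1 - ρ) * r ^ i :=
    (summable_geometric_of_lt_one hr0.le hr1).mul_left _
  have hnear : ∀ᶠ x : ℂ in 𝓝 z, ‖x‖ < r := continuous_norm.continuousAt.eventually_lt_const hrz'
  constructor
  · have key := tendsto_tprod_one_add_of_dominated_convergence (𝓕 := 𝓝 z) (R := ℂ)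
      (f := fun x i => (d : ℂ) * x ^ (i + n + 1) / (1 - (d : ℂ) * x ^ (i + n + 1)))
      (g := fun i => (d : ℂ) * z ^ (i + n + 1) / (1 - (d : ℂ) * z ^ (i + n + 1))) hsum
      (fun k => by
        have : 1 - (d : ℂ) * z ^ (k + n + 1) ≠ 0 := by
          rw [← norm_pos_iff]; linarith [hone z hrz' k]
        exact ContinuousAt.tendsto (by fun_prop (disch := exact this)))
      (hnear.mono hbound)
    have hval : ∏' i : ℕ, (1 + (d : ℂ) * z ^ (i + n + 1) / (1 - (d : ℂ) * z ^ (i + n + 1))) =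
        (∏' i : ℕ, (1 - z ^ (i + 1)))⁻¹ := by
      have hz0 : ∏' i : ℕ, (1 - z ^ (i + 1)) ≠ 0 := by
        simp_rw [sub_eq_add_neg]
        refine tprod_one_add_ne_zero_of_summable (fun i => ?_) ?_
        · rw [← sub_eq_add_neg, sub_ne_zero]
          intro h
          have : ‖z ^ (i + 1)‖ < 1 := by
            rw [norm_pow]; exact pow_lt_one₀ (norm_nonneg _) hz1 (by lia)
          rw [← h] at this; simp at this
        · simpa using (summable_nat_add_iff 1).mpr
            (summable_geometric_of_lt_one (norm_nonneg z) hz1)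
      rw [← (ModularForm.multipliable_one_sub_pow hz1).tprod_inv₀ hz0]
      refine tprod_congr fun i => ?_
      rw [← hsplit z hrz' i, one_div, show (d : ℂ) * z ^ (i + n + 1) = d * z ^ n * z ^ (i + 1) by
        ring, hz, one_mul]
    rw [← hval]
    refine key.congr' (hnear.mono fun x hx => ?_)
    exact tprod_congr fun i => (hsplit x hx i).symm
  · refine hnear.mono fun x hx => ?_
    simp_rw [hsplit x hx]
    exact multipliable_one_add_of_summable
      (Summable.of_nonneg_of_le (fun _ => norm_nonneg _) (hbound x hx) hsum)

/-- Only the factor `1 / (1 - d x^n)` is singular at `z`. As `d x^n = (x/z)^n`, the linear factor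
cancels into a geometric sum, which tends to `n`. -/
theorem tendsto_partitionFun_mul {d n : ℕ} (hd : 2 ≤ d) (hn : 1 ≤ n) {z : ℂ} (hz1 : ‖z‖ < 1)
    (hz : (d : ℂ) * z ^ n = 1) :
    Tendsto (fun x : ℂ => partitionFun d x * (1 - z⁻¹ * x)) (𝓝[≠] z)
      (𝓝 ((∏ i ∈ Finset.range (n - 1), (1 - (d : ℂ) * z ^ (i + 1))⁻¹) * (n : ℂ)⁻¹ *
        (∏' i : ℕ, (1 - z ^ (i + 1)))⁻¹)) := by
  obtain ⟨htail, hmult⟩ := tendsto_tail_partition hd hz1 hz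
  have hz0 : z ≠ 0 := by
    rintro rfl
    rw [zero_pow (by lia)] at hz
    simp at hz
  have hzpos : 0 < ‖z‖ := norm_pos_iff.mpr hz0
  have hzd : (d : ℝ) * ‖z‖ ^ n = 1 := by
    simpa using congrArg norm hz
  have hne : ∀ i ∈ Finset.range (n - 1), 1 - (d : ℂ) * z ^ (i + 1) ≠ 0 := by
    intro i hi h
    rw [Finset.mem_range] at hi
    have h1 : (d : ℝ) * ‖z‖ ^ (i + 1) = 1 := by
      simpa using (congrArg norm (sub_eq_zero.mp h)).symm
    have h2 : ‖z‖ ^ n < ‖z‖ ^ (i + 1) := pow_lt_pow_right_of_lt_one₀ hzpos hz1 (by lia)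
    have h3 : (0 : ℝ) < d := by positivity
    nlinarith
  have hgeom : Tendsto (fun x : ℂ => (∑ k ∈ Finset.range n, (z⁻¹ * x) ^ k)⁻¹) (𝓝 z)
      (𝓝 (n : ℂ)⁻¹) := by
    have h1 : Tendsto (fun x : ℂ => ∑ k ∈ Finset.range n, (z⁻¹ * x) ^ k) (𝓝 z)
        (𝓝 (∑ k ∈ Finset.range n, (z⁻¹ * z) ^ k)) := Continuous.tendsto (by fun_prop) _
    rw [inv_mul_cancel₀ hz0] at h1
    simp only [one_pow, Finset.sum_const, Finset.card_range, nsmul_eq_mul, mul_one] at h1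
    exact h1.inv₀ (by norm_cast; lia)
  have hfin : Tendsto (fun x : ℂ => ∏ i ∈ Finset.range (n - 1), (1 - (d : ℂ) * x ^ (i + 1))⁻¹)
      (𝓝 z) (𝓝 (∏ i ∈ Finset.range (n - 1), (1 - (d : ℂ) * z ^ (i + 1))⁻¹)) :=
    tendsto_finsetProd _ fun i hi =>
      (Continuous.tendsto (f := fun x : ℂ => 1 - (d : ℂ) * x ^ (i + 1)) (by fun_prop) z).inv₀
        (hne i hi)
  refine (((hfin.mul hgeom).mul htail).mono_left nhdsWithin_le_nhds).congr' ?_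
  filter_upwards [hmult.filter_mono nhdsWithin_le_nhds, self_mem_nhdsWithin] with x hx hxz
  have hsplit := Multipliable.prod_mul_tprod_nat_mul' (k := n)
    (f := fun i : ℕ => 1 / (1 - (d : ℂ) * x ^ (i + 1))) hx
  rw [partitionFun, ← hsplit]
  obtain ⟨m, rfl⟩ : ∃ m, n = m + 1 := ⟨n - 1, by lia⟩
  rw [Finset.prod_range_succ]
  simp only [Nat.add_sub_cancel, one_div]
  have hdx : (d : ℂ) * x ^ (m + 1) = (z⁻¹ * x) ^ (m + 1) := by
    rw [mul_pow, inv_pow, eq_inv_of_mul_eq_one_left hz]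
  have hy : 1 - z⁻¹ * x ≠ 0 := by
    intro h
    apply hxz
    have : z⁻¹ * x = 1 := (sub_eq_zero.mp h).symm
    field_simp at this
    exact this
  have hgs : (1 - (z⁻¹ * x)) * ∑ k ∈ Finset.range (m + 1), (z⁻¹ * x) ^ k =
      1 - (z⁻¹ * x) ^ (m + 1) := mul_neg_geom_sum _ _
  have : (1 - (d : ℂ) * x ^ (m + 1))⁻¹ * (1 - z⁻¹ * x) =
      (∑ k ∈ Finset.range (m + 1), (z⁻¹ * x) ^ k)⁻¹ := by
    rw [hdx, ← hgs, mul_inv, mul_right_comm, inv_mul_cancel₀ hy, one_mul]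
  rw [← this]
  ring

theorem tendsto_partitionFun_mul_poleFactor {d n : ℕ} (hd : 2 ≤ d) (hn : 1 ≤ n) (j : ℕ) :
    Tendsto (fun x => partitionFun d x * poleFactor d n j x) (𝓝[≠] (pole d n j))
      (𝓝 ((∏ i ∈ Finset.range (n - 1), (1 - (d : ℂ) * pole d n j ^ (i + 1))⁻¹) * (n : ℂ)⁻¹ *
        (∏' i : ℕ, (1 - pole d n j ^ (i + 1)))⁻¹)) := by
  simp_rw [poleFactor_eq]
  exact tendsto_partitionFun_mul hd hn (by rw [norm_pole hd]; exact radius_lt_one hd hn)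
    (mul_pole_pow hd hn j)

/-- Reversing the order of the factors pairs `k` with `n - k`, and `1 - d z^{n-k} = 1 - z^{-k} =
-z^{-k} (1 - z^k)`. -/
theorem prod_one_sub_mul_pow {d n : ℕ} {z : ℂ} (hz0 : z ≠ 0)
    (hz : (d : ℂ) * z ^ n = 1) :
    ∏ i ∈ Finset.range (n - 1), (1 - (d : ℂ) * z ^ (i + 1))⁻¹ =
      (-1) ^ (n - 1) * (∏ i ∈ Finset.range (n - 1), z ^ (i + 1)) *
        (∏ i ∈ Finset.range (n - 1), (1 - z ^ (i + 1)))⁻¹ := by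
  rw [← Finset.prod_range_reflect, ← Finset.prod_inv_distrib]
  conv_rhs => rw [← Finset.card_range (n - 1), ← Finset.prod_const, Finset.card_range]
  rw [← Finset.prod_mul_distrib, ← Finset.prod_mul_distrib]
  refine Finset.prod_congr rfl fun i hi => ?_
  rw [Finset.mem_range] at hi
  have h1 : (d : ℂ) * z ^ (n - 1 - 1 - i + 1) * z ^ (i + 1) = 1 := by
    rw [mul_assoc, ← pow_add, show n - 1 - 1 - i + 1 + (i + 1) = n by lia, hz]
  have hzi : z ^ (i + 1) ≠ 0 := pow_ne_zero _ hz0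
  rw [eq_inv_of_mul_eq_one_left h1,
    show 1 - (z ^ (i + 1))⁻¹ = -(z ^ (i + 1))⁻¹ * (1 - z ^ (i + 1)) by field_simp; ring, mul_inv,
    inv_neg, inv_inv]
  ring

theorem coeff_eq {d n : ℕ} (hd : 2 ≤ d) (hn : 1 ≤ n) (j : ℕ) :
    coeff d n j = (-1) ^ (n - 1) * (n : ℂ)⁻¹ *
      (∏ i ∈ Finset.range (n - 1), pole d n j ^ (i + 1)) *
      (∏ i ∈ Finset.range (n - 1), (1 - pole d n j ^ (i + 1)))⁻¹ *
      (∏' i : ℕ, (1 - pole d n j ^ (i + 1)))⁻¹ := by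
  rw [coeff, (tendsto_partitionFun_mul_poleFactor hd hn j).limUnder_eq, prod_one_sub_mul_pow _ (mul_pole_pow hd hn j)]
  · ring
  · rw [← norm_pos_iff, norm_pole hd]; exact radius_pos hd n

theorem tendsto_coeff {d n : ℕ} (hd : 2 ≤ d) (hn : 1 ≤ n) (j : ℕ) :
    Tendsto (fun x => partitionFun d x * poleFactor d n j x) (𝓝[≠] (pole d n j))
      (𝓝 (coeff d n j)) :=
  tendsto_nhds_limUnder ⟨_, tendsto_partitionFun_mul_poleFactor hd hn j⟩

theorem norm_coeff {d n : ℕ} (hd : 2 ≤ d) (hn : 1 ≤ n) (j : ℕ) :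
    ‖coeff d n j‖ = (n : ℝ)⁻¹ * (∏ i ∈ Finset.range (n - 1), radius d n ^ (i + 1)) *
      (∏ i ∈ Finset.range (n - 1), ‖1 - pole d n j ^ (i + 1)‖)⁻¹ *
      (∏' i : ℕ, ‖1 - pole d n j ^ (i + 1)‖)⁻¹ := by
  have hm : Multipliable fun i : ℕ => 1 - pole d n j ^ (i + 1) :=
    ModularForm.multipliable_one_sub_pow (by rw [norm_pole hd]; exact radius_lt_one hd hn)
  rw [coeff_eq hd hn, ← hm.norm_tprod]
  simp [norm_prod, norm_pole hd]

theorem pole_zero (d n : ℕ) : pole d n 0 = radius d n := by simp [pole_eq]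

/-! ### Exponential smallness at the complex roots -/

theorem exp_mul_le_one_add_mul {a u : ℝ} (ha : 0 < a) (hu0 : 0 ≤ u) (hu : u ≤ 2) :
    Real.exp (a / (1 + 2 * a) * u) ≤ 1 + a * u := by
  have hpos : 0 < 1 + a * u := by positivity
  have h1 : a / (1 + 2 * a) * u ≤ a * u / (1 + a * u) := by
    rw [div_mul_eq_mul_div]
    exact div_le_div_of_nonneg_left (by positivity) hpos (by nlinarith)
  have h2 : -(a * u / (1 + a * u)) + 1 = (1 + a * u)⁻¹ := by field_simp; ring
  have h3 := Real.add_one_le_exp (-(a * u / (1 + a * u)))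
  rw [h2, Real.exp_neg] at h3
  exact (Real.exp_le_exp.mpr h1).trans ((inv_le_inv₀ hpos (Real.exp_pos _)).mp h3)

/-- For `|ζ| = 1`, `|1 - Qζ|² = (1 - Q)² + 2Q (1 - Re ζ)`. An exponential gain that is linear in `1
- Re ζ` can then be summed over all factors. -/
theorem one_sub_mul_exp_le_norm {a Q : ℝ} (ha : 0 < a) (hQa : a ≤ 2 * Q) (hQ : Q ≤ 1) {ζ : ℂ}
    (hζ : ‖ζ‖ = 1) :
    (1 - Q) * Real.exp (a / (1 + 2 * a) / 2 * (1 - ζ.re)) ≤ ‖1 - (Q : ℂ) * ζ‖ := by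
  have hre := Complex.abs_re_le_norm ζ
  rw [hζ, abs_le] at hre
  set u := 1 - ζ.re with hu
  have hexp := exp_mul_le_one_add_mul ha (u := u) (by linarith) (by linarith)
  have hsq : ζ.re ^ 2 + ζ.im ^ 2 = 1 := by
    have := Complex.sq_norm ζ
    rw [hζ, Complex.normSq_apply] at this
    linarith
  refine le_of_sq_le_sq ?_ (norm_nonneg _)
  rw [Complex.sq_norm, Complex.normSq_apply, mul_pow, ← Real.exp_nat_mul,
    show ((2 : ℕ) : ℝ) * (a / (1 + 2 * a) / 2 * u) = a / (1 + 2 * a) * u by push_cast; ring]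
  simp only [Complex.sub_re, Complex.one_re, Complex.mul_re, Complex.ofReal_re, Complex.ofReal_im,
    zero_mul, sub_zero, Complex.sub_im, Complex.one_im, Complex.mul_im, add_zero]
  have h1 : (1 - Q) ^ 2 * Real.exp (a / (1 + 2 * a) * u) ≤ (1 - Q) ^ 2 * (1 + a * u) := by gcongr
  have h2 : (1 - Q) ^ 2 ≤ 1 := by nlinarith
  have hau : 0 ≤ a * u := mul_nonneg ha.le (by linarith)
  have h3 : (1 - Q) ^ 2 * (a * u) ≤ 2 * Q * u :=
    (mul_le_of_le_one_left hau h2).trans (by nlinarith)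
  have h4 : (1 - Q * ζ.re) * (1 - Q * ζ.re) + (0 - Q * ζ.im) * (0 - Q * ζ.im) =
      (1 - Q) ^ 2 + 2 * Q * u := by
    rw [hu]; linear_combination Q ^ 2 * hsq
  simp only [zero_sub] at h4 ⊢
  linarith

/-- An explicit exponential rate by which the complex-root coefficients are smaller. -/
noncomputable def gap (d : ℕ) : ℝ := (2 / d : ℝ) / (1 + 2 * (2 / d : ℝ)) / 2

theorem gap_pos {d : ℕ} (hd : 2 ≤ d) : 0 < gap d := by
  have : (0 : ℝ) < d := by positivity
  rw [gap]; positivity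

theorem norm_coeff_le {d n j : ℕ} (hd : 2 ≤ d) (hn : 1 ≤ n) (hj : 1 ≤ j) (hjn : j < n) :
    ‖coeff d n j‖ ≤ Real.exp (-gap d * n) * ‖coeff d n 0‖ := by
  have hdpos : (0 : ℝ) < d := by positivity
  set q := radius d n with hq
  have hq0 : 0 < q := radius_pos hd n
  have hq1 : q < 1 := radius_lt_one hd hn
  have hnorm0 : ∀ i : ℕ, ‖1 - pole d n 0 ^ (i + 1)‖ = 1 - q ^ (i + 1) := by
    intro i
    rw [pole_zero, ← Complex.ofReal_pow, ← Complex.ofReal_one, ← Complex.ofReal_sub,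
      Complex.norm_real, Real.norm_of_nonneg]
    linarith [pow_le_one₀ hq0.le hq1.le (n := i + 1)]
  have hpos : ∀ i : ℕ, 0 < 1 - q ^ (i + 1) := fun i => by
    linarith [pow_lt_one₀ hq0.le hq1 (n := i + 1) (by lia)]
  have hle : ∀ i : ℕ, 1 - q ^ (i + 1) ≤ ‖1 - pole d n j ^ (i + 1)‖ := by
    intro i
    have := norm_sub_norm_le (1 : ℂ) (pole d n j ^ (i + 1))
    rwa [norm_one, norm_pow, norm_pole hd] at this
  have hmul : ∀ j, Multipliable fun i : ℕ => ‖1 - pole d n j ^ (i + 1)‖ := fun j =>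
    (ModularForm.multipliable_one_sub_pow (by rw [norm_pole hd]; exact hq1)).norm
  have htprod : ∏' i : ℕ, ‖1 - pole d n 0 ^ (i + 1)‖ ≤ ∏' i : ℕ, ‖1 - pole d n j ^ (i + 1)‖ := by
    refine le_of_tendsto_of_tendsto' (hmul 0).hasProd.tendsto_prod_nat
      (hmul j).hasProd.tendsto_prod_nat fun N => ?_
    refine Finset.prod_le_prod (fun i _ => norm_nonneg _) fun i _ => ?_
    rw [hnorm0]; exact hle i
  have htpos : 0 < ∏' i : ℕ, ‖1 - pole d n 0 ^ (i + 1)‖ := by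
    have h1 : Summable fun i : ℕ => -q ^ (i + 1) :=
      ((summable_nat_add_iff 1).mpr (summable_geometric_of_lt_one hq0.le hq1)).neg
    have h2 : Summable fun i : ℕ => Real.log (1 - q ^ (i + 1)) := by
      simpa [sub_eq_add_neg] using Real.summable_log_one_add_of_summable h1
    simp_rw [hnorm0]
    rw [← Real.rexp_tsum_eq_tprod hpos h2]
    exact Real.exp_pos _
  -- The full sum of powers of `ω^j ≠ 1` vanishes. The omitted exponent `0` contributes `1`, which
  -- turns the count `n - 1` into `n`.
  have hζ : ∑ i ∈ Finset.range (n - 1), (1 - (((omega n) ^ j) ^ (i + 1)).re) = n := by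
    have hprim := omega_isPrimitiveRoot hn
    have hne : omega n ^ j ≠ 1 := hprim.pow_ne_one_of_pos_of_lt (by lia) hjn
    have hgs := mul_neg_geom_sum (omega n ^ j) n
    rw [← pow_mul, mul_comm j, pow_mul, hprim.pow_eq_one, one_pow, sub_self] at hgs
    have hsum : ∑ k ∈ Finset.range n, (omega n ^ j) ^ k = 0 :=
      (mul_eq_zero.mp hgs).resolve_left (sub_ne_zero.mpr hne.symm)
    obtain ⟨m, rfl⟩ : ∃ m, n = m + 1 := ⟨n - 1, by lia⟩
    rw [Finset.sum_range_succ'] at hsum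
    have hre := congrArg Complex.re hsum
    simp only [Complex.add_re, Complex.re_sum, pow_zero, Complex.one_re, Complex.zero_re] at hre
    simp only [Nat.add_sub_cancel, Finset.sum_sub_distrib, Finset.sum_const, Finset.card_range,
      nsmul_eq_mul, mul_one]
    push_cast
    linarith
  have hprod : (∏ i ∈ Finset.range (n - 1), ‖1 - pole d n 0 ^ (i + 1)‖) * Real.exp (gap d * n) ≤
      ∏ i ∈ Finset.range (n - 1), ‖1 - pole d n j ^ (i + 1)‖ := by
    rw [← hζ, Finset.mul_sum, Real.exp_sum, ← Finset.prod_mul_distrib]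
    refine Finset.prod_le_prod (fun i _ => by positivity) fun i hi => ?_
    rw [Finset.mem_range] at hi
    -- This is where `a = 2/d` in `gap` comes from: `q^{i+1} ≥ q^n = 1/d` for every factor in the
    -- range.
    have hQ : (2 / d : ℝ) ≤ 2 * q ^ (i + 1) := by
      rw [div_eq_mul_inv, ← radius_pow hn]
      gcongr 2 * ?_
      exact pow_le_pow_of_le_one hq0.le hq1.le (by lia)
    have := one_sub_mul_exp_le_norm (by positivity) hQ (pow_le_one₀ hq0.le hq1.le)
      (norm_omega_pow n (j * (i + 1)))
    rw [hnorm0, pole_eq, mul_pow, ← Complex.ofReal_pow, ← pow_mul]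
    exact this
  have hppos : 0 < ∏ i ∈ Finset.range (n - 1), ‖1 - pole d n 0 ^ (i + 1)‖ :=
    Finset.prod_pos fun i _ => by rw [hnorm0]; exact hpos i
  have hjpos := inv_nonneg.mpr (htpos.le.trans htprod)
  rw [norm_coeff hd hn, norm_coeff hd hn, neg_mul, Real.exp_neg]
  calc _ ≤ (n : ℝ)⁻¹ * (∏ i ∈ Finset.range (n - 1), q ^ (i + 1)) *
      ((∏ i ∈ Finset.range (n - 1), ‖1 - pole d n 0 ^ (i + 1)‖) * Real.exp (gap d * n))⁻¹ *
      (∏' i : ℕ, ‖1 - pole d n 0 ^ (i + 1)‖)⁻¹ := by gcongr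
    _ = _ := by rw [mul_inv]; ring

theorem norm_poleTerm {d : ℕ} (n j K : ℕ) :
    ‖poleTerm d n j K‖ = ‖coeff d n j‖ * (d : ℝ) ^ ((K : ℝ) / (n : ℝ)) := by
  rw [poleTerm, norm_mul, norm_mul, norm_omega_zpow, mul_one, Complex.norm_real,
    Real.norm_of_nonneg (by positivity)]

/-- All poles of level `n` share the factor `d^{K/n}`, so the bound is uniform in `K`. Half of the
gap pays for the number of terms, through `x ≤ e^x`. -/
theorem norm_sum_poleTerm_le {d n : ℕ} (hd : 2 ≤ d) (hn : 1 ≤ n) (K : ℕ) :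
    ‖∑ j ∈ Finset.Ico 1 n, poleTerm d n j K‖ ≤
      2 / gap d * Real.exp (-(gap d / 2) * n) * ‖poleTerm d n 0 K‖ := by
  have hg := gap_pos hd
  have h1 : ‖∑ j ∈ Finset.Ico 1 n, poleTerm d n j K‖ ≤
      n * (Real.exp (-gap d * n) * ‖poleTerm d n 0 K‖) := by
    refine (norm_sum_le_of_le (f := fun j => poleTerm d n j K)
      (n := fun _ => Real.exp (-gap d * n) * ‖poleTerm d n 0 K‖) _ fun j hj => ?_).trans ?_
    · rw [Finset.mem_Ico] at hj
      rw [norm_poleTerm, norm_poleTerm, ← mul_assoc]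
      gcongr
      exact norm_coeff_le hd hn hj.1 hj.2
    · rw [Finset.sum_const, Nat.card_Ico, nsmul_eq_mul]
      gcongr
      lia
  have h2 : (n : ℝ) * Real.exp (-gap d * n) ≤ 2 / gap d * Real.exp (-(gap d / 2) * n) := by
    have h3 : gap d / 2 * n ≤ Real.exp (gap d / 2 * n) := by
      linarith [Real.add_one_le_exp (gap d / 2 * n)]
    have h4 : Real.exp (-gap d * n) =
        Real.exp (-(gap d / 2) * n) * (Real.exp (gap d / 2 * n))⁻¹ := by
      rw [← Real.exp_neg, ← Real.exp_add]; ring_nf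
    rw [h4, mul_left_comm, mul_comm (2 / gap d)]
    gcongr
    rw [mul_inv_le_iff₀ (Real.exp_pos _)]
    calc (n : ℝ) = 2 / gap d * (gap d / 2 * n) := by field_simp
      _ ≤ _ := by gcongr
  calc _ ≤ _ := h1
    _ = (n * Real.exp (-gap d * n)) * ‖poleTerm d n 0 K‖ := by ring
    _ ≤ _ := by gcongr

/-! ### Euler's product and the modularity of `η` -/

/-- Euler's product `(q; q)_∞ = ∏_{k ≥ 1} (1 - q^k)`. -/
noncomputable def eulerProd (q : ℝ) : ℝ := ∏' i : ℕ, (1 - q ^ (i + 1))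

theorem multipliable_one_sub_mul_pow {q : ℝ} (hq0 : 0 ≤ q) (hq1 : q < 1) (a : ℝ) :
    Multipliable fun i : ℕ => 1 - a * q ^ i := by
  simp_rw [sub_eq_add_neg]
  exact Real.multipliable_one_add_of_summable
    ((summable_geometric_of_lt_one hq0 hq1).mul_left a).neg

theorem multipliable_one_sub_pow_succ {q : ℝ} (hq0 : 0 ≤ q) (hq1 : q < 1) :
    Multipliable fun i : ℕ => 1 - q ^ (i + 1) := by
  simpa [pow_succ'] using multipliable_one_sub_mul_pow hq0 hq1 q

theorem ofReal_eulerProd {q : ℝ} (hq0 : 0 ≤ q) (hq1 : q < 1) :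
    ∏' i : ℕ, (1 - (q : ℂ) ^ (i + 1)) = (eulerProd q : ℂ) := by
  have h := (multipliable_one_sub_pow_succ hq0 hq1).hasProd.map Complex.ofRealHom
    Complex.continuous_ofReal
  have h' := h.tprod_eq
  simpa [Function.comp_def, eulerProd] using h'

theorem eulerProd_pos {q : ℝ} (hq0 : 0 ≤ q) (hq1 : q < 1) : 0 < eulerProd q := by
  have h1 : Summable fun i : ℕ => -q ^ (i + 1) :=
    ((summable_nat_add_iff 1).mpr (summable_geometric_of_lt_one hq0 hq1)).neg
  have h2 : Summable fun i : ℕ => Real.log (1 - q ^ (i + 1)) := by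
    simpa [sub_eq_add_neg] using Real.summable_log_one_add_of_summable h1
  rw [eulerProd, ← Real.rexp_tsum_eq_tprod (fun i => ?_) h2]
  · exact Real.exp_pos _
  · linarith [pow_lt_one₀ hq0 hq1 (n := i + 1) (by lia)]

theorem tendsto_eulerProd_zero : Tendsto eulerProd (𝓝 0) (𝓝 1) := by
  have := tendsto_tprod_one_add_of_dominated_convergence (𝓕 := 𝓝 (0 : ℝ)) (g := (0 : ℕ → ℝ))
    (f := fun (q : ℝ) (n : ℕ) => -q ^ (n + 1)) (bound := fun n => (1 / 2 : ℝ) ^ (n + 1))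
    ((summable_nat_add_iff 1).mpr (summable_geometric_of_lt_one (by norm_num) (by norm_num)))
    (fun k => by simpa using ((continuous_pow (M := ℝ) (k + 1)).tendsto 0).neg) (by
      filter_upwards [Metric.ball_mem_nhds (0 : ℝ) (by norm_num : (0 : ℝ) < 1 / 2)] with q hq k
      rw [norm_neg, norm_pow]
      exact pow_le_pow_left₀ (norm_nonneg _) (mem_ball_zero_iff.mp hq).le _)
  have hfun : eulerProd = fun q : ℝ => ∏' k : ℕ, (1 + -q ^ (k + 1)) := by
    funext q
    simp only [eulerProd, sub_eq_add_neg]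
  rw [hfun]
  simpa using this

theorem norm_eta_mul_I {y : ℝ} (hy : 0 < y) :
    ‖ModularForm.eta (y * Complex.I)‖ =
      Real.exp (-(Real.pi * y / 12)) * eulerProd (Real.exp (-(2 * Real.pi * y))) := by
  have hlt : Real.exp (-(2 * Real.pi * y)) < 1 := by
    rw [Real.exp_lt_one_iff]; have := Real.pi_pos; nlinarith
  have hq : ∀ i : ℕ, ModularForm.eta_q i (y * Complex.I) =
      ((Real.exp (-(2 * Real.pi * y)) : ℝ) : ℂ) ^ (i + 1) := by
    intro i
    rw [ModularForm.eta_q_eq_pow, Complex.ofReal_exp]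
    congr 2
    push_cast
    linear_combination (2 * Real.pi * y : ℂ) * Complex.I_mul_I
  rw [ModularForm.eta, norm_mul, Function.Periodic.norm_qParam]
  simp_rw [hq]
  rw [ofReal_eulerProd (Real.exp_pos _).le hlt, Complex.norm_real,
    Real.norm_of_nonneg (eulerProd_pos (Real.exp_pos _).le hlt).le]
  congr 2
  simp
  ring

theorem norm_sqrt_eq (z : ℂ) : ‖Complex.sqrt z‖ = √‖z‖ := by
  have h : Complex.sqrt z ^ 2 = z := by simp [Complex.sqrt]
  conv_rhs => rw [← h, norm_pow]
  exact (Real.sqrt_sq (norm_nonneg _)).symm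

/-- The transformation law of `η` under `τ ↦ -1/τ` at `τ = iy`, in absolute value. Euler's product
is positive here, so norms lose nothing and no branch of the complex square root matters. -/
theorem eulerProd_modular {y : ℝ} (hy : 0 < y) :
    Real.exp (-(Real.pi / (12 * y))) * eulerProd (Real.exp (-(2 * Real.pi / y))) =
      √y * (Real.exp (-(Real.pi * y / 12)) * eulerProd (Real.exp (-(2 * Real.pi * y)))) := by
  have h := ModularForm.eta_comp_eq_csqrt_I_inv (x := y * Complex.I)
    (by simp [UpperHalfPlane.upperHalfPlaneSet, hy])
  have hinv : -1 / ((y : ℂ) * Complex.I) = ((1 / y : ℝ) : ℂ) * Complex.I := by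
    have : (y : ℂ) ≠ 0 := by exact_mod_cast hy.ne'
    field_simp
    push_cast
    field_simp
    simp
  have h' := congrArg norm h
  simp only [Function.comp_apply, Pi.smul_apply, Pi.mul_apply, smul_eq_mul, norm_mul, norm_inv,
    norm_sqrt_eq, Complex.norm_I, Real.sqrt_one, inv_one, one_mul, hinv, mul_one,
    Complex.norm_real, Real.norm_of_nonneg hy.le] at h'
  rw [norm_eta_mul_I (by positivity), norm_eta_mul_I hy] at h'
  rw [← h']
  congr 3 <;> field_simp

/-- The asymptotics of Euler's product as `q → 1`. -/
theorem eulerProd_exp_neg {t : ℝ} (ht : 0 < t) :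
    eulerProd (Real.exp (-t)) = √(2 * Real.pi / t) * Real.exp (t / 24 - Real.pi ^ 2 / (6 * t)) *
      eulerProd (Real.exp (-(4 * Real.pi ^ 2 / t))) := by
  have hpi := Real.pi_pos
  have h := eulerProd_modular (y := t / (2 * Real.pi)) (by positivity)
  rw [show 2 * Real.pi * (t / (2 * Real.pi)) = t by field_simp,
    show 2 * Real.pi / (t / (2 * Real.pi)) = 4 * Real.pi ^ 2 / t by field_simp; ring,
    show Real.pi / (12 * (t / (2 * Real.pi))) = Real.pi ^ 2 / (6 * t) by field_simp; ring,
    show Real.pi * (t / (2 * Real.pi)) / 12 = t / 24 by field_simp; ring] at h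
  have hs : √(2 * Real.pi / t) * √(t / (2 * Real.pi)) = 1 := by
    rw [← Real.sqrt_mul (by positivity), show 2 * Real.pi / t * (t / (2 * Real.pi)) = 1 by
      field_simp, Real.sqrt_one]
  have he : Real.exp (t / 24) * Real.exp (-(t / 24)) = 1 := by rw [← Real.exp_add]; simp
  rw [sub_eq_add_neg, Real.exp_add]
  calc _ = (√(2 * Real.pi / t) * √(t / (2 * Real.pi))) *
        (Real.exp (t / 24) * Real.exp (-(t / 24))) * eulerProd (Real.exp (-t)) := by
        rw [hs, he]; ring
    _ = √(2 * Real.pi / t) * Real.exp (t / 24) * (√(t / (2 * Real.pi)) *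
        (Real.exp (-(t / 24)) * eulerProd (Real.exp (-t)))) := by ring
    _ = _ := by rw [← h]; ring

/-! ### Asymptotics of the `q`-Pochhammer symbol -/

/-- The bound must hold for all `y > 0`, not only small `y`: in the Lambert series `y = (m+1) t`
with `m` unbounded. -/
theorem abs_inv_one_sub_exp_neg_sub_le {y : ℝ} (hy : 0 < y) :
    |(1 - Real.exp (-y))⁻¹ - y⁻¹ - 1 / 2| ≤ y := by
  have h1 : 0 < 1 - Real.exp (-y) := by
    have : Real.exp (-y) < 1 := by rw [Real.exp_lt_one_iff]; linarith
    linarith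
  rw [abs_le]
  constructor
  · rcases le_or_gt (1 / 2) y with h | h
    · have h2 : y⁻¹ ≤ (1 - Real.exp (-y))⁻¹ := by
        gcongr
        linarith [Real.add_one_le_exp (-y)]
      linarith
    · have h3 := Real.exp_bound' hy.le (by linarith) (n := 3) (by norm_num)
      norm_num [Finset.sum_range_succ, Nat.factorial] at h3
      have h4 : 0 < Real.exp y - 1 := by linarith [Real.add_one_lt_exp hy.ne']
      have h5 : (1 - Real.exp (-y))⁻¹ = 1 + (Real.exp y - 1)⁻¹ := by
        have : Real.exp (-y) = (Real.exp y)⁻¹ := Real.exp_neg y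
        have h6 := Real.exp_pos y
        rw [this] at h1 ⊢
        have h7 : 1 - (Real.exp y)⁻¹ = (Real.exp y - 1) / Real.exp y := by field_simp
        rw [h7, inv_div]
        field_simp
        ring
      have h8 : y⁻¹ - 1 / 2 - y ≤ (Real.exp y - 1)⁻¹ := by
        rw [← one_div (Real.exp y - 1), le_div_iff₀ h4]
        have h9 : 0 ≤ y⁻¹ - 1 / 2 - y := by
          have : 2 ≤ y⁻¹ := by rw [le_inv_comm₀ (by norm_num) hy]; linarith
          linarith
        calc (y⁻¹ - 1 / 2 - y) * (Real.exp y - 1)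
            ≤ (y⁻¹ - 1 / 2 - y) * (y + y ^ 2 / 2 + y ^ 3 * (2 / 9)) := by gcongr; linarith
          _ = 1 - y ^ 2 * (37 / 36) - y ^ 3 * (11 / 18) - y ^ 4 * (2 / 9) := by
            field_simp; ring
          _ ≤ 1 := by have := pow_pos hy 2; have := pow_pos hy 3; have := pow_pos hy 4; linarith
      linarith
  · have h2 := Real.quadratic_le_exp_of_nonneg hy.le
    have h3 : Real.exp (-y) ≤ (1 + y + y ^ 2 / 2)⁻¹ := by
      rw [Real.exp_neg]; gcongr
    have h4 : (1 - Real.exp (-y))⁻¹ ≤ (1 - (1 + y + y ^ 2 / 2)⁻¹)⁻¹ := by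
      gcongr
      have : (1 + y + y ^ 2 / 2)⁻¹ < 1 := inv_lt_one_of_one_lt₀ (by nlinarith)
      linarith
    have h5 : (1 - (1 + y + y ^ 2 / 2)⁻¹)⁻¹ ≤ y⁻¹ + 1 / 2 + y := by
      have h6 : 1 - (1 + y + y ^ 2 / 2)⁻¹ = (y + y ^ 2 / 2) / (1 + y + y ^ 2 / 2) := by
        field_simp; ring
      rw [h6, inv_div, div_le_iff₀ (by positivity)]
      have : (y⁻¹ + 1 / 2 + y) * (y + y ^ 2 / 2) = 1 + y + y ^ 2 * (5 / 4) + y ^ 3 / 2 := by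
        field_simp; ring
      rw [this]
      have := pow_pos hy 2; have := pow_pos hy 3
      linarith
    linarith

theorem summable_Li₂ {b : ℝ} (hb0 : 0 ≤ b) (hb1 : b < 1) :
    Summable fun m : ℕ => b ^ (m + 1) / ((m : ℝ) + 1) ^ 2 := by
  refine Summable.of_nonneg_of_le (fun m => by positivity) (fun m => ?_)
    ((summable_nat_add_iff 1).mpr (summable_geometric_of_lt_one hb0 hb1))
  refine div_le_self (by positivity) (one_le_pow₀ (by linarith [m.cast_nonneg (α := ℝ)]))

/-- The logarithm of the `q`-Pochhammer symbol `(b; q)_∞` as a Lambert series. -/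
theorem tprod_one_sub_mul_pow_eq_exp {b q : ℝ} (hb0 : 0 < b) (hb1 : b < 1) (hq0 : 0 < q)
    (hq1 : q < 1) :
    Summable (fun m : ℕ => b ^ (m + 1) / ((m : ℝ) + 1) * (1 - q ^ (m + 1))⁻¹) ∧
    ∏' i : ℕ, (1 - b * q ^ i) =
      Real.exp (-∑' m : ℕ, b ^ (m + 1) / ((m : ℝ) + 1) * (1 - q ^ (m + 1))⁻¹) := by
  set f : ℕ → ℕ → ℝ := fun i m => (b * q ^ i) ^ (m + 1) / ((m : ℝ) + 1) with hf
  have hbq : ∀ i : ℕ, 0 < b * q ^ i ∧ b * q ^ i < 1 := fun i =>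
    ⟨by positivity, (mul_le_of_le_one_right hb0.le (pow_le_one₀ hq0.le hq1.le)).trans_lt hb1⟩
  -- A summable majorant for the double series, so that the sums over `i` and `m` may be exchanged.
  have hfle : ∀ p : ℕ × ℕ, f p.1 p.2 ≤ q ^ p.1 * b ^ p.2 := by
    rintro ⟨i, m⟩
    simp only [hf]
    refine (div_le_self (by have := (hbq i).1; positivity)
      (by linarith [m.cast_nonneg (α := ℝ)])).trans ?_
    rw [mul_pow, mul_comm]
    refine mul_le_mul ?_ (pow_le_pow_of_le_one hb0.le hb1.le (by lia)) (by positivity)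
      (by positivity)
    rw [← pow_mul]
    exact pow_le_pow_of_le_one hq0.le hq1.le (Nat.le_mul_of_pos_right _ (by lia))
  have hfs : Summable (Function.uncurry f) := by
    refine Summable.of_nonneg_of_le (fun p => ?_) hfle
      ((summable_geometric_of_lt_one hq0.le hq1).mul_of_nonneg
        (summable_geometric_of_lt_one hb0.le hb1) (fun _ => by positivity)
        (fun _ => by positivity))
    have := (hbq p.1).1
    simp only [Function.uncurry, hf]; positivity
  have hrow : ∀ i, HasSum (f i) (-Real.log (1 - b * q ^ i)) := fun i =>
    Real.hasSum_pow_div_log_of_abs_lt_one (by rw [abs_of_pos (hbq i).1]; exact (hbq i).2)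
  have hcol : ∀ m : ℕ, HasSum (fun i => f i m)
      (b ^ (m + 1) / ((m : ℝ) + 1) * (1 - q ^ (m + 1))⁻¹) := by
    intro m
    have hg := (hasSum_geometric_of_lt_one (pow_nonneg hq0.le (m + 1))
      (pow_lt_one₀ hq0.le hq1 (n := m + 1) (by lia))).mul_left (b ^ (m + 1) / ((m : ℝ) + 1))
    refine hg.congr_fun fun i => ?_
    simp only [hf, mul_pow, ← pow_mul]
    rw [mul_comm i]
    ring
  have hs1 := hfs.hasSum.prod_fiberwise hrow
  have hs2 := hfs.prod_symm.hasSum.prod_fiberwise hcol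
  have heq : ∑' p : ℕ × ℕ, Function.uncurry f p.swap = ∑' p, Function.uncurry f p :=
    (Equiv.prodComm ℕ ℕ).tsum_eq (Function.uncurry f)
  refine ⟨hs2.summable, ?_⟩
  rw [hs2.tsum_eq, heq, ← hs1.tsum_eq, ← tsum_neg]
  simp_rw [neg_neg]
  refine (Real.rexp_tsum_eq_tprod (fun i => by linarith [(hbq i).2]) ?_).symm
  simpa using hs1.summable.neg

/-- First-order asymptotics of the `q`-Pochhammer symbol `(b; q)_∞` as `q → 1`. -/
theorem exists_tprod_eq_exp_Li₂ {b : ℝ} (hb0 : 0 < b) (hb1 : b < 1) :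
    ∃ r : ℝ → ℝ, Tendsto r (𝓝[>] 0) (𝓝 0) ∧ ∀ t : ℝ, 0 < t →
      ∏' i : ℕ, (1 - b * Real.exp (-t) ^ i) =
        Real.exp (-(Li₂ b / t) + Real.log (1 - b) / 2 + r t) := by
  have hgs : Summable fun m : ℕ => b ^ (m + 1) :=
    (summable_nat_add_iff 1).mpr (summable_geometric_of_lt_one hb0.le hb1)
  -- In `1/(1 - e^{-y}) = 1/y + 1/2 + O(y)`, the first term sums to `Li₂ b / t` and the second to
  -- `-log(1 - b) / 2`; `e` is the remainder.
  set e : ℝ → ℕ → ℝ := fun t m => b ^ (m + 1) / ((m : ℝ) + 1) *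
    ((1 - Real.exp (-t) ^ (m + 1))⁻¹ - (((m : ℝ) + 1) * t)⁻¹ - 1 / 2) with he
  have hebound : ∀ t, 0 < t → ∀ m, ‖e t m‖ ≤ t * b ^ (m + 1) := by
    intro t ht m
    have hm : (0 : ℝ) < (m : ℝ) + 1 := by positivity
    have h := abs_inv_one_sub_exp_neg_sub_le (y := ((m : ℝ) + 1) * t) (by positivity)
    rw [he, Real.norm_eq_abs, abs_mul, abs_of_pos (by positivity), ← Real.exp_nat_mul,
      show ((m + 1 : ℕ) : ℝ) * -t = -(((m : ℝ) + 1) * t) by push_cast; ring]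
    calc _ ≤ b ^ (m + 1) / ((m : ℝ) + 1) * (((m : ℝ) + 1) * t) := by gcongr
      _ = _ := by field_simp
  refine ⟨fun t => -∑' m, e t m, ?_, fun t ht => ?_⟩
  · have hle : ∀ᶠ t in 𝓝[>] (0 : ℝ), ‖-∑' m, e t m‖ ≤ t * ∑' m : ℕ, b ^ (m + 1) := by
      filter_upwards [self_mem_nhdsWithin] with t ht
      rw [norm_neg]
      refine tsum_of_norm_bounded ?_ (hebound t ht)
      exact hgs.hasSum.mul_left t
    refine squeeze_zero_norm' hle ?_
    have : Tendsto (fun t : ℝ => t * ∑' m : ℕ, b ^ (m + 1)) (𝓝 0)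
        (𝓝 (0 * ∑' m : ℕ, b ^ (m + 1))) := Continuous.tendsto (by fun_prop) _
    rw [zero_mul] at this
    exact this.mono_left nhdsWithin_le_nhds
  · have hq1 : Real.exp (-t) < 1 := by rw [Real.exp_lt_one_iff]; linarith
    obtain ⟨-, hprod⟩ := tprod_one_sub_mul_pow_eq_exp hb0 hb1 (Real.exp_pos (-t)) hq1
    have hes : Summable (e t) := Summable.of_norm_bounded (hgs.mul_left t) (hebound t ht)
    have hL : HasSum (fun m : ℕ => b ^ (m + 1) / ((m : ℝ) + 1) ^ 2 * t⁻¹) (Li₂ b * t⁻¹) :=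
      (summable_Li₂ hb0.le hb1).hasSum.mul_right _
    have hlog := (Real.hasSum_pow_div_log_of_abs_lt_one
      (by rwa [abs_of_pos hb0] : |b| < 1)).mul_right (1 / 2)
    have hall := (hL.add hlog).add hes.hasSum
    rw [hprod]
    congr 1
    rw [show -(Li₂ b / t) + Real.log (1 - b) / 2 + -∑' m, e t m =
      -(Li₂ b * t⁻¹ + -Real.log (1 - b) * (1 / 2) + ∑' m, e t m) by ring, ← hall.tsum_eq]
    congr 1
    refine tsum_congr fun m => ?_
    have hm : (0 : ℝ) < (m : ℝ) + 1 := by positivity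
    simp only [he]
    field_simp
    ring

/-! ### Positivity of the rate -/

theorem Li₂_le {b : ℝ} (hb0 : 0 ≤ b) (hb1 : b < 1) : Li₂ b ≤ b + b ^ 2 / (4 * (1 - b)) := by
  have h := summable_Li₂ hb0 hb1
  have hg := (hasSum_geometric_of_lt_one hb0 hb1).mul_left (b ^ 2 / 4)
  rw [Li₂, h.tsum_eq_zero_add]
  have : ∑' m : ℕ, b ^ (m + 1 + 1) / (((m + 1 : ℕ) : ℝ) + 1) ^ 2 ≤ b ^ 2 / 4 * (1 - b)⁻¹ := by
    rw [← hg.tsum_eq]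
    refine ((summable_nat_add_iff 1).mpr h).tsum_le_tsum (fun m => ?_) hg.summable
    rw [div_le_iff₀ (by positivity)]
    have hm : (4 : ℝ) ≤ (((m + 1 : ℕ) : ℝ) + 1) ^ 2 := by
      push_cast; nlinarith [m.cast_nonneg (α := ℝ)]
    calc b ^ (m + 1 + 1) = b ^ 2 / 4 * b ^ m * 4 := by ring
      _ ≤ _ := by gcongr
  have h2 : b ^ 2 / (4 * (1 - b)) = b ^ 2 / 4 * (1 - b)⁻¹ := by rw [div_mul_eq_div_div]; rfl
  rw [h2]
  norm_num at this ⊢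
  exact this

/-- The only use of `d ≤ 12`. The estimate increases with both `1/d` and `ln d`, so the range is cut
into `2..8` and `9..12`, taking the smallest `d` for `1/d` and the largest for `ln d`. -/
theorem F_lt_pi_sq {d : ℕ} (hd2 : 2 ≤ d) (hd12 : d ≤ 12) : F d < Real.pi ^ 2 := by
  have hpi : (9.8690 : ℝ) < Real.pi ^ 2 := by nlinarith [Real.pi_gt_d6]
  have hdpos : (0 : ℝ) < d := by positivity
  have hl0 : 0 ≤ Real.log d := Real.log_natCast_nonneg d
  have key : ∀ B ℓ : ℝ, (1 / d : ℝ) ≤ B → B < 1 → Real.log d ≤ ℓ →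
      3 * ℓ ^ 2 + 6 * (B + B ^ 2 / (4 * (1 - B))) < 2 * 9.8690 → F d < Real.pi ^ 2 := by
    intro B ℓ hB hB1 hℓ h
    have h1 := Li₂_le (b := 1 / d) (by positivity) (hB.trans_lt hB1)
    have h2 : (1 / d : ℝ) + (1 / d : ℝ) ^ 2 / (4 * (1 - 1 / d)) ≤
        B + B ^ 2 / (4 * (1 - B)) := by gcongr
    have h3 : Real.log d ^ 2 ≤ ℓ ^ 2 := by gcongr
    rw [F]
    linarith
  have hl2 := Real.log_two_lt_d9
  have hl3 := Real.log_three_lt_d9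
  rcases le_or_gt d 8 with h | h
  · have hlog : Real.log d ≤ 3 * Real.log 2 := by
      have : Real.log 8 = 3 * Real.log 2 := by
        rw [show (8 : ℝ) = 2 ^ 3 by norm_num, Real.log_pow]; norm_num
      rw [← this]
      exact Real.log_le_log hdpos (by exact_mod_cast h)
    refine key (1 / 2) 2.0795 ?_ (by norm_num) (by linarith) (by norm_num)
    gcongr
    exact_mod_cast hd2
  · have hlog : Real.log d ≤ 2 * Real.log 2 + Real.log 3 := by
      have : Real.log 12 = 2 * Real.log 2 + Real.log 3 := by
        rw [show (12 : ℝ) = 2 ^ 2 * 3 by norm_num, Real.log_mul (by norm_num) (by norm_num),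
          Real.log_pow]
        norm_num
      rw [← this]
      exact Real.log_le_log hdpos (by exact_mod_cast hd12)
    refine key (1 / 9) 2.485 ?_ (by norm_num) (by linarith) (by norm_num)
    gcongr
    exact_mod_cast h

/-! ### Asymptotics at the real root -/

theorem log_natCast_pos {d : ℕ} (hd : 2 ≤ d) : 0 < Real.log d :=
  Real.log_pos (by exact_mod_cast hd)

theorem radius_eq_exp {d : ℕ} (hd : 2 ≤ d) (n : ℕ) :
    radius d n = Real.exp (-(Real.log d / n)) := by
  rw [radius, Real.rpow_def_of_pos (by positivity)]
  congr 1
  ring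

/-- The absolute value of the real-root coefficient in terms of `q`-Pochhammer symbols. -/
noncomputable def realCoeff (d n : ℕ) : ℝ :=
  (n : ℝ)⁻¹ * Real.exp (-(Real.log d * ((n : ℝ) - 1) / 2)) *
    (∏' i : ℕ, (1 - (d : ℝ)⁻¹ * radius d n ^ i)) * (eulerProd (radius d n))⁻¹ ^ 2

theorem coeff_zero_eq {d n : ℕ} (hd : 2 ≤ d) (hn : 1 ≤ n) :
    coeff d n 0 = (((-1) ^ (n + 1) * realCoeff d n : ℝ) : ℂ) := by
  set q := radius d n with hq
  have hq0 : 0 < q := radius_pos hd n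
  have hq1 : q < 1 := radius_lt_one hd hn
  have hn0 : (n : ℝ) ≠ 0 := by positivity
  -- From exponent `n` on, `q^{n+i} = q^i / d`, so the tail of `(q;q)_∞` is `(1/d;q)_∞`.
  have hshift : ∀ i : ℕ, 1 - q ^ (i + (n - 1) + 1) = 1 - (d : ℝ)⁻¹ * q ^ i := by
    intro i
    rw [show i + (n - 1) + 1 = n + i by lia, pow_add, hq, radius_pow hn]
  have hsplit : (∏ i ∈ Finset.range (n - 1), (1 - q ^ (i + 1))) *
      ∏' i : ℕ, (1 - (d : ℝ)⁻¹ * q ^ i) = eulerProd q := by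
    have := Multipliable.prod_mul_tprod_nat_mul' (k := n - 1) (f := fun i : ℕ => 1 - q ^ (i + 1))
      (by simp_rw [hshift]; exact multipliable_one_sub_mul_pow hq0.le hq1 _)
    simp_rw [hshift] at this
    exact this
  have hinv : (∏ i ∈ Finset.range (n - 1), (1 - q ^ (i + 1)))⁻¹ =
      (∏' i : ℕ, (1 - (d : ℝ)⁻¹ * q ^ i)) * (eulerProd q)⁻¹ := by
    have hE := (eulerProd_pos hq0.le hq1).ne'
    rw [← hsplit] at hE ⊢
    rw [mul_inv, mul_left_comm, mul_inv_cancel₀ (right_ne_zero_of_mul hE), mul_one]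
  have hpow : ∏ i ∈ Finset.range (n - 1), q ^ (i + 1) =
      Real.exp (-(Real.log d * ((n : ℝ) - 1) / 2)) := by
    rw [Finset.prod_pow_eq_pow_sum, hq, radius_eq_exp hd, ← Real.exp_nat_mul]
    congr 1
    have hsum : ∀ m : ℕ, ((∑ i ∈ Finset.range m, (i + 1) : ℕ) : ℝ) = m * (m + 1) / 2 := by
      intro m
      induction m with
      | zero => simp
      | succ k ih => rw [Finset.sum_range_succ, Nat.cast_add, ih]; push_cast; ring
    rw [hsum, Nat.cast_sub hn]
    field_simp
    push_cast
    ring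
  have hsign : (-1 : ℂ) ^ (n - 1) = (-1) ^ (n + 1) := by
    obtain ⟨m, rfl⟩ : ∃ m, n = m + 1 := ⟨n - 1, by lia⟩
    simp [pow_succ]
  rw [coeff_eq hd hn, pole_zero, ← hq, ofReal_eulerProd hq0.le hq1, hsign]
  rw [realCoeff, ← hq, ← hpow, inv_pow, sq, mul_inv]
  have : (∏ i ∈ Finset.range (n - 1), (1 - (q : ℂ) ^ (i + 1)))⁻¹ =
      (((∏' i : ℕ, (1 - (d : ℝ)⁻¹ * q ^ i)) * (eulerProd q)⁻¹ : ℝ) : ℂ) := by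
    rw [← hinv]; push_cast; rfl
  rw [this]
  push_cast
  ring

/-- The claimed leading asymptotics of `|c_{n;0}|`. -/
noncomputable def leading (d n : ℕ) : ℝ :=
  (Real.sqrt ((d : ℝ) - 1) * Real.log d / (2 * Real.pi)) *
        (1 / (n : ℝ) ^ 2) * Real.exp ((n : ℝ) * rate d)

theorem leading_pos {d n : ℕ} (hd : 2 ≤ d) (hn : 1 ≤ n) : 0 < leading d n := by
  have := log_natCast_pos hd
  have h2 : (2 : ℝ) ≤ d := by exact_mod_cast hd
  have : 0 < √((d : ℝ) - 1) := Real.sqrt_pos.mpr (by linarith)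
  have := Real.pi_pos
  rw [leading]
  positivity

theorem tendsto_realCoeff_div {d : ℕ} (hd : 2 ≤ d) :
    Tendsto (fun n => realCoeff d n / leading d n) atTop (𝓝 1) := by
  set ℓ := Real.log d with hℓ
  have hℓ0 : 0 < ℓ := log_natCast_pos hd
  have hpi := Real.pi_pos
  have hd2 : (2 : ℝ) ≤ d := by exact_mod_cast hd
  obtain ⟨r, hr, hA⟩ := exists_tprod_eq_exp_Li₂ (b := (d : ℝ)⁻¹) (by positivity)
    (inv_lt_one_of_one_lt₀ (by linarith))
  -- An exact identity: all main terms cancel, leaving the Lambert remainder, the `t/24` terms and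
  -- the dual Euler product at `e^{-4π²/t} → 0`.
  have hkey : ∀ n : ℕ, 1 ≤ n → realCoeff d n / leading d n =
      Real.exp (r (ℓ / n) - ℓ / n / 12) *
        (eulerProd (Real.exp (-(4 * Real.pi ^ 2 / (ℓ / n)))))⁻¹ ^ 2 := by
    intro n hn
    have hn0 : (0 : ℝ) < n := by positivity
    have ht : 0 < ℓ / n := by positivity
    rw [div_eq_iff (leading_pos hd hn).ne', realCoeff, leading, radius_eq_exp hd, hA _ ht,
      eulerProd_exp_neg ht]
    set ε := eulerProd (Real.exp (-(4 * Real.pi ^ 2 / (ℓ / n))))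
    rw [← hℓ]
    have hs : √(2 * Real.pi / (ℓ / n)) ^ 2 = 2 * Real.pi / (ℓ / n) := Real.sq_sqrt (by positivity)
    have hsd : √((d : ℝ) - 1) = Real.exp (Real.log ((d : ℝ) - 1) / 2) := by
      rw [← Real.log_sqrt (by linarith), Real.exp_log (Real.sqrt_pos.mpr (by linarith))]
    have hlog : Real.log (1 - (d : ℝ)⁻¹) = Real.log ((d : ℝ) - 1) - ℓ := by
      rw [hℓ, ← Real.log_div (by linarith) (by linarith)]
      congr 1
      field_simp
    rw [mul_inv, mul_inv, mul_pow, mul_pow, inv_pow √_, hs, ← Real.exp_neg, ← Real.exp_nat_mul,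
      hsd, hlog]
    have hexp : Real.exp (-(ℓ * ((n : ℝ) - 1) / 2)) *
        Real.exp (-(Li₂ (d : ℝ)⁻¹ / (ℓ / n)) + (Real.log ((d : ℝ) - 1) - ℓ) / 2 + r (ℓ / n)) *
        Real.exp ((2 : ℕ) * -(ℓ / n / 24 - Real.pi ^ 2 / (6 * (ℓ / n)))) =
        Real.exp (r (ℓ / n) - ℓ / n / 12) * Real.exp (Real.log ((d : ℝ) - 1) / 2) *
          Real.exp (n * rate d) := by
      rw [← Real.exp_add, ← Real.exp_add, ← Real.exp_add, ← Real.exp_add]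
      congr 1
      rw [rate, F, ← hℓ, one_div]
      field_simp
      push_cast
      ring
    calc _ = (n : ℝ)⁻¹ * (2 * Real.pi / (ℓ / n))⁻¹ * ε⁻¹ ^ 2 *
        (Real.exp (-(ℓ * ((n : ℝ) - 1) / 2)) *
        Real.exp (-(Li₂ (d : ℝ)⁻¹ / (ℓ / n)) + (Real.log ((d : ℝ) - 1) - ℓ) / 2 + r (ℓ / n)) *
        Real.exp ((2 : ℕ) * -(ℓ / n / 24 - Real.pi ^ 2 / (6 * (ℓ / n))))) := by ring
      _ = _ := by rw [hexp]; field_simp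
  have ht0 : Tendsto (fun n : ℕ => ℓ / (n : ℝ)) atTop (𝓝 0) :=
    tendsto_const_div_atTop_nhds_zero_nat ℓ
  have ht : Tendsto (fun n : ℕ => ℓ / (n : ℝ)) atTop (𝓝[>] 0) :=
    tendsto_nhdsWithin_iff.mpr ⟨ht0, (eventually_ge_atTop 1).mono fun n hn => by
      have : (0 : ℝ) < n := by positivity
      exact div_pos hℓ0 this⟩
  have h1 : Tendsto (fun n : ℕ => Real.exp (r (ℓ / n) - ℓ / n / 12)) atTop (𝓝 1) := by
    have := (Real.continuous_exp.tendsto _).comp ((hr.comp ht).sub (ht0.div_const 12))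
    simpa [Function.comp_def] using this
  have h2 : Tendsto (fun n : ℕ => Real.exp (-(4 * Real.pi ^ 2 / (ℓ / (n : ℝ))))) atTop (𝓝 0) := by
    refine Real.tendsto_exp_atBot.comp (tendsto_neg_atTop_atBot.comp ?_)
    have : (fun n : ℕ => 4 * Real.pi ^ 2 / (ℓ / (n : ℝ))) =
        fun n : ℕ => 4 * Real.pi ^ 2 / ℓ * (n : ℝ) := by
      ext n; rw [div_div_eq_mul_div]; ring
    rw [this]
    exact tendsto_natCast_atTop_atTop.const_mul_atTop (by positivity)
  have h3 := h1.mul (((tendsto_eulerProd_zero.comp h2).inv₀ one_ne_zero).pow 2)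
  simp only [inv_one, one_pow, mul_one] at h3
  exact h3.congr' ((eventually_ge_atTop 1).mono fun n hn => (hkey n hn).symm)

theorem coeff_zero_isEquivalent {d : ℕ} (hd : 2 ≤ d) :
    (fun n : ℕ => coeff d n 0) ~[atTop] fun n => (((-1) ^ (n + 1) * leading d n : ℝ) : ℂ) := by
  refine isEquivalent_of_tendsto_one ?_
  have h := (Complex.continuous_ofReal.tendsto 1).comp (tendsto_realCoeff_div hd)
  rw [Complex.ofReal_one] at h
  refine h.congr' ((eventually_ge_atTop 1).mono fun n hn => ?_)
  rw [Pi.div_apply, coeff_zero_eq hd hn, ← Complex.ofReal_div,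
    mul_div_mul_left _ _ (pow_ne_zero _ (by norm_num))]
  rfl

/-! ### Growth of the level terms and divergence -/

theorem exists_exp_le_norm_coeff_zero {d : ℕ} (hd : 2 ≤ d) (hrate : 0 < rate d) :
    ∃ μ : ℝ, 0 < μ ∧ ∀ᶠ n : ℕ in atTop, 2 * Real.exp (μ * n) ≤ ‖coeff d n 0‖ := by
  -- Half of the rate absorbs `n^{-2}` and the constants. The factor `2` is reserved for the passage
  -- to `levelTerm`, which may lose half of the main term.
  refine ⟨rate d / 2, by positivity, ?_⟩
  set c := √((d : ℝ) - 1) * Real.log d / (2 * Real.pi) with hc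
  have hc0 : 0 < c := by
    have := log_natCast_pos hd
    have h2 : (2 : ℝ) ≤ d := by exact_mod_cast hd
    have : 0 < √((d : ℝ) - 1) := Real.sqrt_pos.mpr (by linarith)
    have := Real.pi_pos
    positivity
  have hgrow : Tendsto (fun n : ℕ => Real.exp (rate d / 2 * n) / (n : ℝ) ^ (2 : ℝ)) atTop atTop :=
    (tendsto_exp_mul_div_rpow_atTop 2 (rate d / 2) (by positivity)).comp
      tendsto_natCast_atTop_atTop
  filter_upwards [eventually_ge_atTop 1, hgrow.eventually_ge_atTop (4 / c),
    (tendsto_realCoeff_div hd).eventually_const_lt (by norm_num : (1 / 2 : ℝ) < 1)]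
    with n hn hg hr
  have hn0 : (0 : ℝ) < n := by positivity
  rw [lt_div_iff₀ (leading_pos hd hn)] at hr
  have hnorm : ‖coeff d n 0‖ = |realCoeff d n| := by
    rw [coeff_zero_eq hd hn, Complex.norm_real, norm_mul]; simp
  rw [hnorm]
  refine le_trans ?_ (hr.le.trans (le_abs_self _))
  have hexp : Real.exp (n * rate d) = Real.exp (rate d / 2 * n) * Real.exp (rate d / 2 * n) := by
    rw [← Real.exp_add]; ring_nf
  rw [div_le_iff₀ hc0, Real.rpow_two] at hg
  rw [leading, ← hc, hexp]
  calc 2 * Real.exp (rate d / 2 * n) = 1 / 2 * 4 * Real.exp (rate d / 2 * n) := by ring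
    _ ≤ 1 / 2 * (Real.exp (rate d / 2 * n) / (n : ℝ) ^ 2 * c) * Real.exp (rate d / 2 * n) := by
      gcongr
    _ = _ := by ring

theorem levelTerm_isEquivalent {d : ℕ} (hd : 2 ≤ d) (K : ℕ) :
    (fun n : ℕ => levelTerm d n K) ~[atTop] fun n => poleTerm d n 0 K := by
  have hg := gap_pos hd
  have hdecay : Tendsto (fun n : ℕ => 2 / gap d * Real.exp (-(gap d / 2) * n)) atTop (𝓝 0) := by
    have h : Tendsto (fun n : ℕ => -(gap d / 2) * (n : ℝ)) atTop atBot :=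
      tendsto_natCast_atTop_atTop.const_mul_atTop_of_neg (by linarith)
    simpa using (Real.tendsto_exp_atBot.comp h).const_mul (2 / gap d)
  refine isLittleO_iff.mpr fun ε hε => ?_
  filter_upwards [eventually_ge_atTop 1, hdecay.eventually_lt_const hε] with n hn hsmall
  have hsplit : levelTerm d n K - poleTerm d n 0 K = ∑ j ∈ Finset.Ico 1 n, poleTerm d n j K := by
    rw [levelTerm, Finset.range_eq_Ico, Finset.sum_eq_sum_Ico_succ_bot (by lia)]
    ring
  rw [Pi.sub_apply, hsplit]
  exact (norm_sum_poleTerm_le hd hn K).trans (by gcongr)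

theorem exists_exp_le_norm_levelTerm {d : ℕ} (hd : 2 ≤ d) (hrate : 0 < rate d) (K : ℕ) :
    ∃ μ : ℝ, 0 < μ ∧ ∀ᶠ n : ℕ in atTop, Real.exp (μ * n) ≤ ‖levelTerm d n K‖ := by
  obtain ⟨μ, hμ, hgrow⟩ := exists_exp_le_norm_coeff_zero hd hrate
  refine ⟨μ, hμ, ?_⟩
  filter_upwards [hgrow, isLittleO_iff.mp (levelTerm_isEquivalent hd K) (c := 1 / 2) (by norm_num)]
    with n hn hclose
  rw [Pi.sub_apply] at hclose
  have h1 : ‖coeff d n 0‖ ≤ ‖poleTerm d n 0 K‖ := by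
    rw [norm_poleTerm]
    refine le_mul_of_one_le_right (norm_nonneg _) ?_
    exact Real.one_le_rpow (by exact_mod_cast (by lia : 1 ≤ d)) (by positivity)
  have h2 := norm_sub_norm_le (poleTerm d n 0 K) (levelTerm d n K)
  rw [norm_sub_rev] at h2
  linarith

/-- Convergence would force consecutive partial sums to differ by `o(1)`, but eventually every term
has norm at least `1`. -/
theorem not_tendsto_sum_levelTerm {d : ℕ} (hd : 2 ≤ d) (hrate : 0 < rate d) (K : ℕ) :
    ¬ ∃ S : ℂ, Tendsto (fun M : ℕ => ∑ n ∈ Finset.Icc 1 M, levelTerm d n K) atTop (𝓝 S) := by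
  rintro ⟨S, hS⟩
  obtain ⟨μ, hμ, hgrow⟩ := exists_exp_le_norm_levelTerm hd hrate K
  have hdiff := ((hS.comp (tendsto_add_atTop_nat 1)).sub hS).norm
  rw [sub_self, norm_zero] at hdiff
  obtain ⟨n, hn, hlt⟩ := (((tendsto_add_atTop_nat 1).eventually hgrow).and
    (hdiff.eventually_lt_const one_pos)).exists
  simp only [Function.comp_apply, Finset.sum_Icc_succ_top (show 1 ≤ n + 1 by lia),
    add_sub_cancel_left] at hlt
  have : 1 ≤ Real.exp (μ * ((n + 1 : ℕ) : ℝ)) := Real.one_le_exp (by positivity)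
  linarith

end DMatrix

theorem mainTheorem2 (d : ℕ) (hd2 : 2 ≤ d) (hd12 : d ≤ 12) :
    -- the limits defining the coefficients exist
    (∀ n : ℕ, 1 ≤ n → ∀ j : ℕ, j < n →
      Tendsto (fun x => DMatrix.partitionFun d x * DMatrix.poleFactor d n j x)
        (𝓝[≠] (DMatrix.pole d n j)) (𝓝 (DMatrix.coeff d n j))) ∧
    -- the exponential rate is positive
    (DMatrix.F d < Real.pi ^ 2 ∧ 0 < DMatrix.rate d) ∧
    -- asymptotics of the real-root coefficients
    ((fun n : ℕ => DMatrix.coeff d n 0) ~[atTop]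
      (fun n : ℕ => (((-1 : ℝ) ^ (n + 1) * (Real.sqrt ((d : ℝ) - 1) * Real.log d / (2 * Real.pi)) *
        (1 / (n : ℝ) ^ 2) * Real.exp ((n : ℝ) * DMatrix.rate d) : ℝ) : ℂ))) ∧
    -- the complex-root coefficients are exponentially smaller, uniformly in `j`
    (∃ C δ : ℝ, 0 < C ∧ 0 < δ ∧ ∀ n : ℕ, 1 ≤ n → ∀ j : ℕ, 1 ≤ j → j < n →
      ‖DMatrix.coeff d n j‖ ≤ C * Real.exp (-δ * (n : ℝ)) * ‖DMatrix.coeff d n 0‖) ∧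
    -- so are their total contributions to the level-`n` terms
    (∃ C δ : ℝ, 0 < C ∧ 0 < δ ∧ ∀ K n : ℕ, 1 ≤ n →
      ‖∑ j ∈ Finset.Ico 1 n, DMatrix.poleTerm d n j K‖
        ≤ C * Real.exp (-δ * (n : ℝ)) * ‖DMatrix.poleTerm d n 0 K‖) ∧
    -- the level-`n` terms are dominated by the real root and grow exponentially,
    -- and the pole series diverges
    (∀ K : ℕ,
      ((fun n : ℕ => DMatrix.levelTerm d n K) ~[atTop]
        (fun n : ℕ => DMatrix.poleTerm d n 0 K)) ∧
      (∃ μ : ℝ, 0 < μ ∧ ∀ᶠ n : ℕ in atTop, Real.exp (μ * (n : ℝ)) ≤ ‖DMatrix.levelTerm d n K‖) ∧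
      ¬ ∃ S : ℂ, Tendsto (fun M : ℕ => ∑ n ∈ Finset.Icc 1 M, DMatrix.levelTerm d n K)
        atTop (𝓝 S)) := by
  have hF := DMatrix.F_lt_pi_sq hd2 hd12
  have hrate : 0 < DMatrix.rate d := by
    have := DMatrix.log_natCast_pos hd2
    exact div_pos (by linarith) (by linarith)
  have hgap := DMatrix.gap_pos hd2
  refine ⟨fun n hn j _ => DMatrix.tendsto_coeff hd2 hn j, ⟨hF, hrate⟩, ?_,
    ⟨1, DMatrix.gap d, one_pos, hgap, fun n hn j hj hjn => ?_⟩,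
    ⟨2 / DMatrix.gap d, DMatrix.gap d / 2, by positivity, by positivity,
      fun K n hn => DMatrix.norm_sum_poleTerm_le hd2 hn K⟩,
    fun K => ⟨DMatrix.levelTerm_isEquivalent hd2 K,
      DMatrix.exists_exp_le_norm_levelTerm hd2 hrate K,
      DMatrix.not_tendsto_sum_levelTerm hd2 hrate K⟩⟩
  · refine (DMatrix.coeff_zero_isEquivalent hd2).congr_right (.of_forall fun n => ?_)
    simp only [DMatrix.leading, mul_assoc]
  · rw [one_mul]
    exact DMatrix.norm_coeff_le hd2 hn hj hjn
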